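/- Let $\mathbb{C}^+=\{z\in\mathbb{C}:\operatorname{Re} z>0\}$ and let $\varphi\in H^\infty(\mathbb{C}^+)$, i.e. $\varphi$ is a bounded analytic function on $\mathbb{C}^+$. Then $\varphi$ has a nontangential limit $\varphi(iy)$ at $iy$ for almost every $y\in\mathbb{R}$, and the boundary function $y\mapsto\varphi(iy)$ belongs to $L^\infty(\mathbb{R})$. A topologically invariant mean is a continuous linear functional $\Phi$ on the complex space $L^\infty(\mathbb{R})$ such that $\Phi(\psi)\ge 0$ whenever $\psi\ge 0$, $\Phi(1)=1$, and $\Phi(f*\psi)=\Phi(\psi)$ for all $\psi\in L^\infty(\mathbb{R})$ and all $f\in L^1(\mathbb{R})$ with $f\ge 0$ and $\int_{\mathbb{R}} f(x)\,dx=1$, where $(f*\psi)(x)=\int_{\mathbb{R}}\psi(x-t)f(t)\,dt$. A function $\psi\in L^\infty(\mathbb{R})$ is almost convergent to $\alpha\in\mathbb{C}$ if $\Phi(\psi)=\alpha$ for every topologically invariant mean $\Phi$. For every $\alpha\in\mathbb{C}$ the following are equivalent: 1. the boundary function $y\mapsto\varphi(iy)$ is almost convergent to $\alpha$; 2. $\displaystyle\lim_{\theta\to\infty}\frac{1}{2\theta}\int_{y-\theta}^{y+\theta}\varphi(it)\,dt=\alpha$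 uniformly in $y\in\mathbb{R}$; 3. $\displaystyle\lim_{x\to\infty}\varphi(x+iy)=\alpha$ uniformly in $y\in\mathbb{R}$. -/

import Mathlib

open MeasureTheory Filter Topology
open scoped ENNReal ComplexOrder Convolution

namespace AlmostConvergence

/-- The Banach space `L^∞(ℝ)` of (classes of) complex-valued essentially bounded functions. -/
abbrev LInfty : Type := Lp ℂ ∞ (volume : Measure ℝ)

/-- The constant function `1` as an element of `L^∞(ℝ)`. -/
noncomputable def oneLInfty : LInfty :=
  (memLp_top_const (1 : ℂ) : MemLp (fun _ : ℝ => (1 : ℂ)) ∞ volume).toLp _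

/-- `f ∈ P(ℝ)`: `f ∈ L¹(ℝ)`, `f ≥ 0` and `∫ f = 1`. -/
structure IsDensity (f : ℝ → ℝ) : Prop where
  integrable : Integrable f
  nonneg : 0 ≤ᵐ[volume] f
  integral_eq_one : ∫ t, f t = 1

/-- The convolution `(f * ψ)(x) = ∫ f(t) ψ(x - t) dt` of an `L¹` and an `L^∞` function. -/
noncomputable def conv (f : ℝ → ℝ) (ψ : ℝ → ℂ) : ℝ → ℂ :=
  f ⋆[ContinuousLinearMap.lsmul ℝ ℝ, volume] ψ

theorem memLp_conv {f : ℝ → ℝ} (hf : Integrable f) (ψ : LInfty) :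
    MemLp (conv f ψ) ∞ volume := by
  have hψ := Lp.aestronglyMeasurable ψ
  refine memLp_top_of_bound (C := ∫ t, ‖f t‖ * ‖ψ‖) ?_ ?_
  · exact (hf.aestronglyMeasurable.convolution_integrand
      (ContinuousLinearMap.lsmul ℝ ℝ) hψ).integral_prod_right'
  · refine Eventually.of_forall fun x => ?_
    have hb : ∀ᵐ t : ℝ, ‖ψ t‖ ≤ ‖ψ‖ := by
      have := ae_le_eLpNormEssSup (f := (ψ : ℝ → ℂ)) (μ := volume)
      filter_upwards [this] with t ht
      rw [Lp.norm_def, eLpNorm_exponent_top, ← toReal_enorm]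
      refine ENNReal.toReal_mono ?_ ht
      rw [← eLpNorm_exponent_top]
      exact Lp.eLpNorm_ne_top ψ
    have hb' : ∀ᵐ t : ℝ, ‖ψ (x - t)‖ ≤ ‖ψ‖ :=
      (Measure.measurePreserving_sub_left volume x).quasiMeasurePreserving.ae hb
    refine norm_integral_le_of_norm_le (hf.norm.mul_const _) ?_
    filter_upwards [hb'] with t ht
    simp only [ContinuousLinearMap.lsmul_apply, norm_smul]
    gcongr

/-- A mean on `L^∞(ℝ)`: a positive continuous linear functional with `Φ 1 = 1`. -/
structure IsMean (Φ : StrongDual ℂ LInfty) : Prop where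
  nonneg : ∀ ψ : LInfty, (∀ᵐ x : ℝ, 0 ≤ ψ x) → 0 ≤ Φ ψ
  map_one : Φ oneLInfty = 1

/-- A topologically invariant mean: `Φ (f * ψ) = Φ ψ` for `f ∈ P(ℝ)` and `ψ ∈ L^∞(ℝ)`. -/
structure IsTopologicallyInvariantMean (Φ : StrongDual ℂ LInfty) : Prop extends IsMean Φ where
  map_conv : ∀ (f : ℝ → ℝ) (hf : IsDensity f) (ψ : LInfty),
    Φ ((memLp_conv hf.integrable ψ).toLp (conv f ψ)) = Φ ψ

/-- `ψ ∈ L^∞(ℝ)` is almost convergent to `α`. -/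
def AlmostConvergent (ψ : LInfty) (α : ℂ) : Prop :=
  ∀ Φ : StrongDual ℂ LInfty, IsTopologicallyInvariantMean Φ → Φ ψ = α

/-- The open right half plane. -/
def rightHalfPlane : Set ℂ := {z | 0 < z.re}

/-- `φ ∈ H^∞(ℂ⁺)`. The values of `φ` outside the open right half plane play no role. -/
structure MemHInfty (φ : ℂ → ℂ) : Prop where
  analytic : DifferentiableOn ℂ φ rightHalfPlane
  bounded : ∃ C : ℝ, ∀ z ∈ rightHalfPlane, ‖φ z‖ ≤ C

/-- The cone of aperture `M` in the open right half plane with vertex `i y`. -/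
def stolzCone (y M : ℝ) : Set ℂ := {z | 0 < z.re ∧ |z.im - y| ≤ M * z.re}

/-- Nontangential approach to `i y`: convergence along this filter is convergence to `i y`
inside each cone `stolzCone y M`. -/
noncomputable def nontangential (y : ℝ) : Filter ℂ :=
  ⨆ M : ℝ, 𝓝[stolzCone y M] (Complex.I * y)

/-- The boundary function `y ↦ φ(iy)` given by the nontangential limits of `φ` (with an
unspecified value at the points where there is no such limit). -/
noncomputable def boundaryFunction (φ : ℂ → ℂ) (y : ℝ) : ℂ :=
  limUnder (nontangential y) φ

end AlmostConvergence

namespace AlmostConvergence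

theorem conv_apply (f : ℝ → ℝ) (ψ : ℝ → ℂ) (x : ℝ) :
    conv f ψ x = ∫ t, f t • ψ (x - t) := rfl

theorem ae_norm_le_norm (ψ : LInfty) : ∀ᵐ t : ℝ, ‖ψ t‖ ≤ ‖ψ‖ := by
  filter_upwards [ae_le_eLpNormEssSup (f := (ψ : ℝ → ℂ)) (μ := volume)] with t ht
  rw [Lp.norm_def, eLpNorm_exponent_top, ← toReal_enorm]
  refine ENNReal.toReal_mono ?_ ht
  rw [← eLpNorm_exponent_top]
  exact Lp.eLpNorm_ne_top ψ

/-- Every element of `L^∞(ℝ)` has a representative that is bounded everywhere by its norm. -/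
theorem exists_bounded_representative (ψ : LInfty) :
    ∃ ψ' : ℝ → ℂ, StronglyMeasurable ψ' ∧ (∀ t, ‖ψ' t‖ ≤ ‖ψ‖) ∧ (ψ : ℝ → ℂ) =ᵐ[volume] ψ' := by
  have hm := Lp.stronglyMeasurable ψ
  refine ⟨{t | ‖ψ t‖ ≤ ‖ψ‖}.indicator ψ,
    hm.indicator (measurableSet_le hm.norm.measurable measurable_const), fun t => ?_, ?_⟩
  · by_cases h : ‖ψ t‖ ≤ ‖ψ‖
    · rwa [Set.indicator_of_mem (by exact h)]
    · rw [Set.indicator_of_notMem (by exact h), norm_zero]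
      exact norm_nonneg _
  · filter_upwards [ae_norm_le_norm ψ] with t ht
    rw [Set.indicator_of_mem (by exact ht)]

theorem conv_congr_right (f : ℝ → ℝ) {ψ ψ' : ℝ → ℂ} (h : ψ =ᵐ[volume] ψ') :
    conv f ψ = conv f ψ' :=
  convolution_congr _ (ae_eq_refl f) h

theorem integrable_smul_of_bounded {f : ℝ → ℝ} (hf : Integrable f) {ψ : ℝ → ℂ}
    (hψ : AEStronglyMeasurable ψ) {C : ℝ} (hC : ∀ t, ‖ψ t‖ ≤ C) :
    Integrable fun t => f t • ψ t :=
  hf.smul_bdd C hψ (Eventually.of_forall hC)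

theorem integrable_conv_integrand {f : ℝ → ℝ} (hf : Integrable f) {ψ : ℝ → ℂ}
    (hψ : StronglyMeasurable ψ) {C : ℝ} (hC : ∀ t, ‖ψ t‖ ≤ C) (x : ℝ) :
    Integrable fun t => f t • ψ (x - t) :=
  integrable_smul_of_bounded hf
    (hψ.comp_measurable (measurable_const.sub measurable_id)).aestronglyMeasurable fun _ => hC _

theorem integrable_conv_integrand_Lp {f : ℝ → ℝ} (hf : Integrable f) (ψ : LInfty) (x : ℝ) :
    Integrable fun t => f t • ψ (x - t) := by
  obtain ⟨ψ', hm, hb, he⟩ := exists_bounded_representative ψ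
  refine (integrable_conv_integrand hf hm hb x).congr ?_
  have := (Measure.measurePreserving_sub_left volume x).quasiMeasurePreserving.ae he
  filter_upwards [this] with t ht
  rw [ht]

theorem IsDensity.integral_norm {f : ℝ → ℝ} (hf : IsDensity f) : ∫ t, ‖f t‖ = 1 := by
  rw [← hf.integral_eq_one]
  refine integral_congr_ae ?_
  filter_upwards [hf.nonneg] with t ht
  exact Real.norm_of_nonneg ht

theorem IsDensity.norm_conv_le {f : ℝ → ℝ} (hf : IsDensity f) {ψ : ℝ → ℂ} {C : ℝ}
    (hC : ∀ t, ‖ψ t‖ ≤ C) (x : ℝ) : ‖conv f ψ x‖ ≤ C := by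
  calc ‖conv f ψ x‖ ≤ ∫ t, ‖f t‖ * C := by
        refine norm_integral_le_of_norm_le (hf.integrable.norm.mul_const _)
          (Eventually.of_forall fun t => ?_)
        simp only [ContinuousLinearMap.lsmul_apply, norm_smul]
        gcongr
        exact hC _
    _ = C := by rw [integral_mul_const, hf.integral_norm, one_mul]

/-- The functional `ψ ↦ (f * ψ)(y)` on `L^∞(ℝ)`. -/
noncomputable def convEval {f : ℝ → ℝ} (hf : IsDensity f) (y : ℝ) : StrongDual ℂ LInfty :=
  LinearMap.mkContinuous
    { toFun := fun ψ => conv f ψ y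
      map_add' := fun ψ χ => by
        rw [conv_congr_right f (Lp.coeFn_add ψ χ), conv_apply, conv_apply, conv_apply,
          ← integral_add (integrable_conv_integrand_Lp hf.integrable ψ y)
            (integrable_conv_integrand_Lp hf.integrable χ y)]
        simp only [Pi.add_apply, smul_add]
      map_smul' := fun c ψ => by
        rw [conv_congr_right f (Lp.coeFn_smul c ψ), conv_apply, conv_apply, RingHom.id_apply,
          ← integral_smul]
        simp only [Pi.smul_apply, smul_comm c] }
    1 fun ψ => by
      obtain ⟨ψ', -, hb, he⟩ := exists_bounded_representative ψ
      rw [one_mul, LinearMap.coe_mk, AddHom.coe_mk, conv_congr_right f he]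
      exact hf.norm_conv_le hb y

theorem convEval_apply {f : ℝ → ℝ} (hf : IsDensity f) (y : ℝ) (ψ : LInfty) :
    convEval hf y ψ = conv f ψ y := rfl

theorem norm_convEval_le {f : ℝ → ℝ} (hf : IsDensity f) (y : ℝ) : ‖convEval hf y‖ ≤ 1 :=
  LinearMap.mkContinuous_norm_le _ zero_le_one _

theorem convEval_nonneg {f : ℝ → ℝ} (hf : IsDensity f) (y : ℝ) (ψ : LInfty)
    (h : ∀ᵐ x : ℝ, 0 ≤ ψ x) : 0 ≤ convEval hf y ψ := by
  rw [convEval_apply, conv_apply]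
  refine integral_nonneg_of_ae ?_
  filter_upwards [hf.nonneg,
    (Measure.measurePreserving_sub_left volume y).quasiMeasurePreserving.ae h] with t h1 h2
  exact smul_nonneg h1 h2

theorem IsDensity.conv_const {f : ℝ → ℝ} (hf : IsDensity f) (c : ℂ) (y : ℝ) :
    conv f (fun _ => c) y = c := by
  rw [conv_apply, integral_smul_const, hf.integral_eq_one, one_smul]

theorem coeFn_oneLInfty : (oneLInfty : ℝ → ℂ) =ᵐ[volume] fun _ => 1 :=
  MemLp.coeFn_toLp _

theorem convEval_one {f : ℝ → ℝ} (hf : IsDensity f) (y : ℝ) :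
    convEval hf y oneLInfty = 1 := by
  rw [convEval_apply, conv_congr_right f coeFn_oneLInfty, hf.conv_const]

theorem conv_conv_comm {f k : ℝ → ℝ} (hf : Integrable f) (hk : Integrable k) {ψ : ℝ → ℂ}
    (hψ : StronglyMeasurable ψ) {C : ℝ} (hC : ∀ t, ‖ψ t‖ ≤ C) (y : ℝ) :
    conv k (conv f ψ) y = conv f (conv k ψ) y := by
  simp only [conv_apply, ← integral_smul]
  rw [integral_integral_swap]
  · refine integral_congr_ae (Eventually.of_forall fun s => ?_)
    refine integral_congr_ae (Eventually.of_forall fun t => ?_)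
    simp only
    rw [smul_comm, sub_right_comm]
  · have h := (Integrable.mul_prod hk hf).smul_bdd (C := C)
      (f := fun p : ℝ × ℝ => ψ (y - p.1 - p.2)) ?_ (Eventually.of_forall fun p => hC _)
    · refine h.congr (Eventually.of_forall fun p => ?_)
      simp only [Function.uncurry, smul_smul, Pi.smul_apply']
    · exact (hψ.comp_measurable (by fun_prop)).aestronglyMeasurable

/-- The `L¹` modulus of continuity of `k` for the translation by `s`. -/
noncomputable def translationModulus (k : ℝ → ℝ) (s : ℝ) : ℝ := ∫ u, ‖k (u - s) - k u‖

theorem continuous_translationModulus {k : ℝ → ℝ} (hk : Integrable k) :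
    Continuous (translationModulus k) := by
  have : Fact ((1 : ℝ≥0∞) ≠ ∞) := ⟨ENNReal.one_ne_top⟩
  have hm : MemLp k 1 volume := memLp_one_iff_integrable.2 hk
  have h1 : Continuous fun s : ℝ => (DomAddAct.mk (-s) +ᵥ hm.toLp k) - hm.toLp k :=
    ((DomAddAct.continuous_mk.comp continuous_neg).vadd continuous_const).sub continuous_const
  refine h1.norm.congr fun s => ?_
  rw [L1.norm_eq_integral_norm, translationModulus]
  refine integral_congr_ae ?_
  rw [DomAddAct.mk_vadd_toLp, ← MemLp.toLp_sub]
  filter_upwards [MemLp.coeFn_toLp ((hm.comp_measurePreserving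
    (measurePreserving_vadd (-s) volume)).sub hm)] with u hu
  refine (congrArg norm hu).trans ?_
  simp [sub_eq_add_neg, add_comm]

theorem translationModulus_zero (k : ℝ → ℝ) : translationModulus k 0 = 0 := by
  simp [translationModulus]

theorem translationModulus_nonneg (k : ℝ → ℝ) (s : ℝ) : 0 ≤ translationModulus k s :=
  integral_nonneg fun _ => norm_nonneg _

theorem IsDensity.translationModulus_le {k : ℝ → ℝ} (hk : IsDensity k) (s : ℝ) :
    translationModulus k s ≤ 2 := by
  calc translationModulus k s ≤ ∫ u, (‖k (u - s)‖ + ‖k u‖) := by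
        refine integral_mono_of_nonneg (Eventually.of_forall fun _ => norm_nonneg _)
          ((hk.integrable.comp_sub_right s).norm.add hk.integrable.norm)
          (Eventually.of_forall fun u => norm_sub_le _ _)
    _ = 2 := by
        rw [integral_add (hk.integrable.comp_sub_right s).norm hk.integrable.norm,
          integral_sub_right_eq_self (fun u => ‖k u‖), hk.integral_norm]
        norm_num

theorem conv_apply_swap (f : ℝ → ℝ) (ψ : ℝ → ℂ) (x : ℝ) :
    conv f ψ x = ∫ t, f (x - t) • ψ t := by
  rw [conv_apply, ← integral_sub_left_eq_self _ volume x]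
  simp only [sub_sub_cancel]

theorem norm_conv_sub_conv_le {k : ℝ → ℝ} (hk : Integrable k) {ψ : ℝ → ℂ}
    (hψ : StronglyMeasurable ψ) {C : ℝ} (hC : ∀ t, ‖ψ t‖ ≤ C) (y s : ℝ) :
    ‖conv k ψ (y - s) - conv k ψ y‖ ≤ translationModulus k s * C := by
  have hi : ∀ x, Integrable fun t => k (x - t) • ψ t := fun x =>
    integrable_smul_of_bounded (hk.comp_sub_left x) hψ.aestronglyMeasurable hC
  rw [conv_apply_swap, conv_apply_swap, ← integral_sub (hi _) (hi _)]
  have h : translationModulus k s = ∫ t, ‖k (y - s - t) - k (y - t)‖ := by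
    rw [translationModulus, ← integral_sub_left_eq_self _ volume y]
    simp only [sub_right_comm]
  rw [h, ← integral_mul_const]
  refine norm_integral_le_of_norm_le
    (((hk.comp_sub_left (y - s)).sub (hk.comp_sub_left y)).norm.mul_const C)
    (Eventually.of_forall fun t => ?_)
  rw [← sub_smul, norm_smul]
  gcongr
  exact hC t

theorem norm_conv_conv_sub_conv_le {f k : ℝ → ℝ} (hf : IsDensity f) (hk : IsDensity k)
    {ψ : ℝ → ℂ} (hψ : StronglyMeasurable ψ) {C : ℝ} (hC : ∀ t, ‖ψ t‖ ≤ C) (y : ℝ) :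
    ‖conv k (conv f ψ) y - conv k ψ y‖ ≤ (∫ s, f s * translationModulus k s) * C := by
  rw [conv_conv_comm hf.integrable hk.integrable hψ hC]
  have hcont : Continuous (conv k ψ) := by
    rw [continuous_iff_continuousAt]
    intro x
    have h0 : Tendsto (fun z => translationModulus k (x - z) * C) (𝓝 x) (𝓝 0) := by
      have := ((continuous_translationModulus hk.integrable).comp
        (continuous_const.sub continuous_id : Continuous fun z => x - z)).mul_const C
      simpa [translationModulus_zero] using this.tendsto x
    refine tendsto_iff_norm_sub_tendsto_zero.2 (squeeze_zero (fun _ => norm_nonneg _)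
      (fun z => ?_) h0)
    simpa using norm_conv_sub_conv_le hk.integrable hψ hC x (x - z)
  have h1 : conv k ψ y = ∫ s, f s • conv k ψ y := by
    rw [integral_smul_const, hf.integral_eq_one, one_smul]
  have hi : Integrable fun s => f s • conv k ψ (y - s) :=
    integrable_conv_integrand hf.integrable hcont.stronglyMeasurable (hk.norm_conv_le hC) y
  rw [conv_apply, h1, ← integral_sub hi (hf.integrable.smul_const _), ← integral_mul_const]
  refine norm_integral_le_of_norm_le ?_ ?_
  · refine Integrable.mul_const (hf.integrable.mul_bdd (c := 2)
      (continuous_translationModulus hk.integrable).aestronglyMeasurable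
      (Eventually.of_forall fun s => ?_)) C
    rw [Real.norm_of_nonneg (translationModulus_nonneg k s)]
    exact hk.translationModulus_le s
  · filter_upwards [hf.nonneg] with s hs
    rw [← smul_sub, norm_smul, Real.norm_of_nonneg hs, mul_assoc]
    exact mul_le_mul_of_nonneg_left (norm_conv_sub_conv_le hk.integrable hψ hC y s) hs

/-- A family of densities is asymptotically translation invariant in `L¹`. -/
def AsymptoticallyInvariant (k : ℝ → ℝ → ℝ) : Prop :=
  ∀ s, Tendsto (fun x => translationModulus (k x) s) atTop (𝓝 0)

theorem AsymptoticallyInvariant.tendsto_integral {k : ℝ → ℝ → ℝ} (hk : ∀ x, IsDensity (k x))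
    (h : AsymptoticallyInvariant k) {f : ℝ → ℝ} (hf : IsDensity f) :
    Tendsto (fun x => ∫ s, f s * translationModulus (k x) s) atTop (𝓝 0) := by
  have := tendsto_integral_filter_of_dominated_convergence (μ := volume) (l := (atTop : Filter ℝ))
    (F := fun x s => f s * translationModulus (k x) s) (f := fun _ => 0) (fun s => ‖f s‖ * 2)
    (Eventually.of_forall fun x => hf.integrable.aestronglyMeasurable.mul
      (continuous_translationModulus (hk x).integrable).aestronglyMeasurable)
    (Eventually.of_forall fun x => Eventually.of_forall fun s => ?_)
    (hf.integrable.norm.mul_const 2)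
    (Eventually.of_forall fun s => by simpa using (h s).const_mul (f s))
  · simpa using this
  · rw [norm_mul, Real.norm_of_nonneg (translationModulus_nonneg (k x) s)]
    gcongr
    exact (hk x).translationModulus_le s

/-- Along every ultrafilter at infinity, the functionals `ψ ↦ (kₓ * ψ)(y)` converge to a
topologically invariant mean. -/
theorem exists_isTopologicallyInvariantMean {k : ℝ → ℝ → ℝ} (hk : ∀ x, IsDensity (k x))
    (h : AsymptoticallyInvariant k) (U : Ultrafilter (ℝ × ℝ))
    (hU : Tendsto Prod.fst (U : Filter (ℝ × ℝ)) atTop) :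
    ∃ Φ : StrongDual ℂ LInfty, IsTopologicallyInvariantMean Φ ∧
      ∀ ψ : LInfty, Tendsto (fun p : ℝ × ℝ => conv (k p.1) ψ p.2) U (𝓝 (Φ ψ)) := by
  let T : ℝ × ℝ → WeakDual ℂ LInfty := fun p =>
    StrongDual.toWeakDual (convEval (hk p.1) p.2)
  have hT : ∀ p, T p ∈ WeakDual.toStrongDual ⁻¹'
      Metric.closedBall (0 : StrongDual ℂ LInfty) 1 := fun p =>
    mem_closedBall_zero_iff.2 (norm_convEval_le (hk p.1) p.2)
  obtain ⟨Λ, -, hΛ⟩ := (WeakDual.isCompact_closedBall _ _).ultrafilter_le_nhds' (U.map T)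
    (Ultrafilter.mem_map.2 (univ_mem' hT))
  have hlim : ∀ ψ : LInfty, Tendsto (fun p : ℝ × ℝ => conv (k p.1) ψ p.2) U (𝓝 (Λ ψ)) :=
    fun ψ => ((WeakDual.eval_continuous ψ).tendsto Λ).comp (f := T) hΛ
  refine ⟨WeakDual.toStrongDual Λ, ⟨⟨fun ψ hψ => ?_, ?_⟩, fun f hf ψ => ?_⟩, hlim⟩
  · exact ge_of_tendsto' (hlim ψ) fun p => convEval_nonneg (hk p.1) p.2 ψ hψ
  · refine tendsto_nhds_unique (hlim oneLInfty) ?_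
    exact tendsto_const_nhds.congr fun p => (convEval_one (hk p.1) p.2).symm
  · obtain ⟨ψ', hm, hb, he⟩ := exists_bounded_representative ψ
    refine eq_of_sub_eq_zero (tendsto_nhds_unique ((hlim _).sub (hlim ψ)) ?_)
    have h0 : Tendsto (fun p : ℝ × ℝ =>
        (∫ s, f s * translationModulus (k p.1) s) * ‖ψ‖) U (𝓝 0) := by
      simpa using ((h.tendsto_integral hk hf).comp hU).mul_const ‖ψ‖
    refine squeeze_zero_norm (fun p => ?_) h0
    rw [conv_congr_right _ (MemLp.coeFn_toLp (memLp_conv hf.integrable ψ)),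
      conv_congr_right f he, conv_congr_right _ he]
    exact norm_conv_conv_sub_conv_le hf (hk p.1) hm hb p.2

theorem norm_le_of_ae_bound {ψ : LInfty} {C : ℝ} (hC : 0 ≤ C) (h : ∀ᵐ t, ‖ψ t‖ ≤ C) :
    ‖ψ‖ ≤ C := by
  rw [Lp.norm_def]
  refine ENNReal.toReal_le_of_le_ofReal hC ?_
  rw [eLpNorm_exponent_top]
  exact eLpNormEssSup_le_of_ae_bound h

theorem almostConvergent_iff_tendstoUniformly_conv {k : ℝ → ℝ → ℝ} (hk : ∀ x, IsDensity (k x))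
    (h : AsymptoticallyInvariant k) (ψ : LInfty) (α : ℂ) :
    AlmostConvergent ψ α ↔
      TendstoUniformly (fun x y => conv (k x) ψ y) (fun _ => α) atTop := by
  constructor
  · intro hψ
    rw [← tendsto_prod_top_iff, tendsto_iff_ultrafilter]
    intro U hU
    obtain ⟨Φ, hΦ, hlim⟩ := exists_isTopologicallyInvariantMean hk h U (tendsto_fst.mono_left hU)
    rw [← hψ Φ hΦ]
    exact hlim ψ
  · intro hu Φ hΦ
    have h1 : Tendsto (fun x => (memLp_conv (hk x).integrable ψ).toLp (conv (k x) ψ)) atTop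
        (𝓝 (α • oneLInfty)) := by
      rw [Metric.tendsto_nhds]
      intro ε hε
      filter_upwards [Metric.tendstoUniformly_iff.1 hu (ε / 2) (half_pos hε)] with x hx
      rw [dist_eq_norm]
      refine (norm_le_of_ae_bound (half_pos hε).le ?_).trans_lt (half_lt_self hε)
      filter_upwards [Lp.coeFn_sub ((memLp_conv (hk x).integrable ψ).toLp (conv (k x) ψ))
        (α • oneLInfty), MemLp.coeFn_toLp (memLp_conv (hk x).integrable ψ),
        Lp.coeFn_smul α oneLInfty, coeFn_oneLInfty] with y e1 e2 e3 e4
      rw [e1, Pi.sub_apply, e2, e3, Pi.smul_apply, e4, smul_eq_mul, mul_one, ← dist_eq_norm,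
        dist_comm]
      exact (hx y).le
    have h2 := (Φ.continuous.tendsto _).comp h1
    rw [map_smul, hΦ.map_one, smul_eq_mul, mul_one] at h2
    refine tendsto_nhds_unique ?_ h2
    exact tendsto_const_nhds.congr fun x => (hΦ.map_conv _ (hk x) ψ).symm

/-- The dilate `t ↦ x⁻¹ K(t / x)` of `K`, made constant in `x` for `x ≤ 1`. -/
noncomputable def dilate (K : ℝ → ℝ) (x t : ℝ) : ℝ := (max x 1)⁻¹ * K (t / max x 1)

theorem IsDensity.dilate {K : ℝ → ℝ} (hK : IsDensity K) (x : ℝ) : IsDensity (dilate K x) := by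
  have hx : 0 < max x 1 := lt_max_of_lt_right one_pos
  refine ⟨(hK.integrable.comp_div hx.ne').const_mul _, ?_, ?_⟩
  · have hq : Measure.QuasiMeasurePreserving (fun t : ℝ => t / max x 1) volume volume := by
      refine ⟨by fun_prop, ?_⟩
      simp only [div_eq_mul_inv]
      rw [Real.map_volume_mul_right (inv_ne_zero hx.ne')]
      exact Measure.smul_absolutelyContinuous
    filter_upwards [hq.ae hK.nonneg] with t ht
    exact mul_nonneg (inv_nonneg.2 hx.le) ht
  · simp only [AlmostConvergence.dilate]
    rw [integral_const_mul, Measure.integral_comp_div K, hK.integral_eq_one, abs_of_pos hx]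
    simp [hx.ne']

theorem translationModulus_dilate (K : ℝ → ℝ) (x s : ℝ) :
    translationModulus (dilate K x) s = translationModulus K (s / max x 1) := by
  have hx : 0 < max x 1 := lt_max_of_lt_right one_pos
  have := Measure.integral_comp_div (fun u => ‖K (u - s / max x 1) - K u‖) (max x 1)
  simp only [translationModulus, dilate, ← mul_sub, norm_mul, integral_const_mul, ← sub_div] at *
  rw [this, abs_of_pos hx, Real.norm_of_nonneg (inv_nonneg.2 hx.le), smul_eq_mul,
    inv_mul_cancel_left₀ hx.ne']

theorem IsDensity.asymptoticallyInvariant_dilate {K : ℝ → ℝ} (hK : IsDensity K) :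
    AsymptoticallyInvariant (AlmostConvergence.dilate K) := by
  intro s
  simp only [translationModulus_dilate]
  have h1 : Tendsto (fun x : ℝ => s / max x 1) atTop (𝓝 0) :=
    tendsto_const_nhds.div_atTop (tendsto_atTop_mono (fun x => le_max_left x 1) tendsto_id)
  have h2 := ((continuous_translationModulus hK.integrable).tendsto 0).comp h1
  rwa [translationModulus_zero] at h2

/-- Almost convergence is detected by the averages against the dilates of any one density. -/
theorem IsDensity.almostConvergent_iff {K : ℝ → ℝ} (hK : IsDensity K) (ψ : LInfty) (α : ℂ)
    {A : ℝ → ℝ → ℂ} (hA : ∀ x, 1 ≤ x → ∀ y, A x y = ∫ t, (x⁻¹ * K (t / x)) • ψ (y - t)) :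
    AlmostConvergent ψ α ↔ TendstoUniformly A (fun _ => α) atTop := by
  rw [almostConvergent_iff_tendstoUniformly_conv hK.dilate hK.asymptoticallyInvariant_dilate]
  simp only [Metric.tendstoUniformly_iff]
  refine forall₂_congr fun ε _ => eventually_congr ?_
  filter_upwards [eventually_ge_atTop 1] with x hx
  simp only [conv_apply, AlmostConvergence.dilate, hA x hx, max_eq_left hx]

theorem isOpen_rightHalfPlane : IsOpen rightHalfPlane :=
  isOpen_lt continuous_const Complex.continuous_re

theorem convex_rightHalfPlane : Convex ℝ rightHalfPlane :=
  convex_halfSpace_re_gt 0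

theorem exists_mem_ball_natCast {z : ℂ} (hz : z ∈ rightHalfPlane) :
    ∃ n : ℕ, 1 ≤ n ∧ z ∈ Metric.ball (n : ℂ) n := by
  have hz' : 0 < z.re := hz
  obtain ⟨n, hn⟩ := exists_nat_gt (max 1 (‖z‖ ^ 2 / z.re))
  have h1 : (1 : ℝ) < n := (le_max_left _ _).trans_lt hn
  have h2 : ‖z‖ ^ 2 < n * z.re := (div_lt_iff₀ hz').1 ((le_max_right _ _).trans_lt hn)
  refine ⟨n, by exact_mod_cast h1.le, ?_⟩
  rw [Metric.mem_ball, dist_eq_norm]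
  refine lt_of_pow_lt_pow_left₀ 2 (by positivity) ?_
  rw [← Complex.normSq_eq_norm_sq, Complex.normSq_apply] at h2 ⊢
  simp only [Complex.sub_re, Complex.natCast_re, Complex.sub_im, Complex.natCast_im]
  nlinarith [mul_pos (zero_lt_one.trans h1) hz']

theorem ball_natCast_subset_rightHalfPlane (n : ℕ) :
    Metric.ball (n : ℂ) n ⊆ rightHalfPlane := by
  intro z hz
  rw [Metric.mem_ball, dist_eq_norm] at hz
  have := (abs_lt.1 ((Complex.abs_re_le_norm _).trans_lt hz)).1
  simp only [Complex.sub_re, Complex.natCast_re] at this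
  change 0 < z.re
  linarith

/-- A holomorphic function on the right half plane has a primitive. -/
theorem exists_primitive {φ : ℂ → ℂ} (hφ : DifferentiableOn ℂ φ rightHalfPlane) :
    ∃ F : ℂ → ℂ, ∀ z ∈ rightHalfPlane, HasDerivAt F (φ z) z := by
  have hB : ∀ n : ℕ, ∃ F : ℂ → ℂ, ∀ z ∈ Metric.ball (n : ℂ) n, HasDerivAt F (φ z) z :=
    fun n => (hφ.mono (ball_natCast_subset_rightHalfPlane n)).isExactOn_ball
  choose F hF using hB
  have one_mem : ∀ n : ℕ, 1 ≤ n → (1 : ℂ) ∈ Metric.ball (n : ℂ) n := by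
    intro n hn
    have h1 : (1 : ℝ) ≤ n := by exact_mod_cast hn
    rw [Metric.mem_ball, dist_eq_norm, ← Complex.ofReal_natCast, ← Complex.ofReal_one,
      ← Complex.ofReal_sub, Complex.norm_real, Real.norm_eq_abs, abs_lt]
    constructor <;> linarith
  have agree : ∀ m n : ℕ, 1 ≤ m → 1 ≤ n → ∀ z ∈ Metric.ball (m : ℂ) m, z ∈ Metric.ball (n : ℂ) n →
      F m z - F m 1 = F n z - F n 1 := by
    intro m n hm hn z hzm hzn
    have hd : ∀ w ∈ Metric.ball (m : ℂ) m ∩ Metric.ball (n : ℂ) n,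
        HasDerivAt (fun w => F m w - F n w) 0 w := fun w hw => by
      have h := (hF m w hw.1).sub (hF n w hw.2)
      rwa [sub_self] at h
    have := (Metric.isOpen_ball.inter Metric.isOpen_ball).is_const_of_deriv_eq_zero
      ((convex_ball (m : ℂ) (m : ℝ)).inter (convex_ball (n : ℂ) (n : ℝ))).isPreconnected
      (fun w hw => (hd w hw).differentiableAt.differentiableWithinAt)
      (fun w hw => (hd w hw).deriv) ⟨hzm, hzn⟩ ⟨one_mem m hm, one_mem n hn⟩
    linear_combination this
  choose! N hN using fun (z : ℂ) (hz : z ∈ rightHalfPlane) => exists_mem_ball_natCast hz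
  refine ⟨fun z => F (N z) z - F (N z) 1, fun z hz => ?_⟩
  refine ((hF (N z) z (hN z hz).2).sub_const (F (N z) 1)).congr_of_eventuallyEq ?_
  filter_upwards [Metric.isOpen_ball.mem_nhds (hN z hz).2] with w hw
  have hw' := ball_natCast_subset_rightHalfPlane _ hw
  exact agree _ _ (hN w hw').1 (hN z hz).1 w (hN w hw').2 hw

/-- The closed right half plane. -/
def closedRightHalfPlane : Set ℂ := {z | 0 ≤ z.re}

theorem rightHalfPlane_subset_closed : rightHalfPlane ⊆ closedRightHalfPlane :=
  fun z hz => (le_of_lt hz : 0 ≤ z.re)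

theorem closedRightHalfPlane_mem_nhds {z : ℂ} (hz : z ∈ rightHalfPlane) :
    closedRightHalfPlane ∈ 𝓝 z :=
  mem_of_superset (isOpen_rightHalfPlane.mem_nhds hz) rightHalfPlane_subset_closed

theorem mul_I_mem_closedRightHalfPlane (t : ℝ) : (t : ℂ) * Complex.I ∈ closedRightHalfPlane := by
  simp [closedRightHalfPlane]

/-- Cauchy's theorem on the right half plane for functions that decay quadratically. -/
theorem integral_imaginaryAxis_eq_zero {q : ℂ → ℂ} (hc : ContinuousOn q closedRightHalfPlane)
    (hd : DifferentiableOn ℂ q rightHalfPlane) {C R₀ : ℝ}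
    (hC : ∀ w ∈ closedRightHalfPlane, R₀ ≤ ‖w‖ → ‖q w‖ ≤ C / ‖w‖ ^ 2) :
    ∫ t : ℝ, q (t * Complex.I) = 0 := by
  have hcont : Continuous fun t : ℝ => q (t * Complex.I) :=
    hc.comp_continuous (by fun_prop) mul_I_mem_closedRightHalfPlane
  have hO : (fun t : ℝ => q (t * Complex.I)) =O[cocompact ℝ] fun t : ℝ => (1 + t ^ 2)⁻¹ := by
    refine Asymptotics.IsBigO.of_bound (2 * |C|) ?_
    filter_upwards [tendsto_norm_cocompact_atTop.eventually_ge_atTop (max R₀ 1)] with t ht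
    have ht1 : 1 ≤ |t| := (le_max_right _ _).trans ht
    have hn : ‖(t : ℂ) * Complex.I‖ = |t| := by simp
    have h := hC _ (mul_I_mem_closedRightHalfPlane t)
      (by rw [hn]; exact (le_max_left _ _).trans ht)
    rw [hn, sq_abs] at h
    have h2 : 1 ≤ t ^ 2 := by rw [← sq_abs]; nlinarith
    refine h.trans ?_
    rw [Real.norm_of_nonneg (by positivity), ← div_eq_mul_inv,
      div_le_div_iff₀ (by positivity) (by positivity)]
    nlinarith [le_abs_self C, abs_nonneg C, mul_le_mul_of_nonneg_right (le_abs_self C)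
      (by positivity : (0 : ℝ) ≤ 1 + t ^ 2), mul_le_mul_of_nonneg_left h2 (abs_nonneg C)]
  have hint : Integrable fun t : ℝ => q (t * Complex.I) :=
    hcont.locallyIntegrable.integrable_of_isBigO_cocompact hO
      (integrable_inv_one_add_sq.integrableAtFilter _)
  have h1 : Tendsto (fun R : ℝ => ∫ t in (-R)..R, q (t * Complex.I)) atTop
      (𝓝 (∫ t : ℝ, q (t * Complex.I))) :=
    intervalIntegral_tendsto_integral hint tendsto_neg_atTop_atBot tendsto_id
  have h2 : Tendsto (fun R : ℝ => 4 * C / R) atTop (𝓝 0) :=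
    tendsto_const_nhds.div_atTop tendsto_id
  refine tendsto_nhds_unique h1 (squeeze_zero_norm' ?_ h2)
  filter_upwards [eventually_ge_atTop (max R₀ 1)] with R hR
  have hR1 : 1 ≤ R := (le_max_right _ _).trans hR
  have hR0 : 0 < R := one_pos.trans_le hR1
  have hbound : ∀ w ∈ closedRightHalfPlane, R ≤ ‖w‖ → ‖q w‖ ≤ C / R ^ 2 := by
    intro w hw hRw
    have h := hC w hw (((le_max_left _ _).trans hR).trans hRw)
    have hC0 : 0 ≤ C := by
      have hw0 : 0 < ‖w‖ ^ 2 := pow_pos (hR0.trans_le hRw) 2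
      simpa using (le_div_iff₀ hw0).1 ((norm_nonneg _).trans h)
    exact h.trans (by gcongr)
  have hrect := Complex.integral_boundary_rect_eq_zero_of_continuousOn_of_differentiableOn q
    (-R * Complex.I) (R + R * Complex.I) ?_ ?_
  · simp only [neg_mul, Complex.neg_re, Complex.mul_re, Complex.ofReal_re, Complex.I_re, mul_zero,
      Complex.ofReal_im, Complex.I_im, mul_one, sub_self, neg_zero, Complex.add_re, add_zero,
      Complex.neg_im, Complex.mul_im, Complex.add_im, zero_add, Complex.ofReal_neg,
      Complex.ofReal_zero, smul_eq_mul] at hrect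
    have e1 : ‖∫ x in (0 : ℝ)..R, q (x + -(R * Complex.I))‖ ≤ C / R ^ 2 * |R - 0| := by
      refine intervalIntegral.norm_integral_le_of_norm_le_const fun x hx => ?_
      rw [Set.uIoc_of_le hR0.le] at hx
      refine hbound _ (by simpa [closedRightHalfPlane] using hx.1.le) ?_
      refine le_trans ?_ (Complex.abs_im_le_norm _)
      simp [abs_of_pos hR0]
    have e2 : ‖∫ x in (0 : ℝ)..R, q (x + R * Complex.I)‖ ≤ C / R ^ 2 * |R - 0| := by
      refine intervalIntegral.norm_integral_le_of_norm_le_const fun x hx => ?_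
      rw [Set.uIoc_of_le hR0.le] at hx
      refine hbound _ (by simpa [closedRightHalfPlane] using hx.1.le) ?_
      refine le_trans ?_ (Complex.abs_im_le_norm _)
      simp [abs_of_pos hR0]
    have e3 : ‖∫ y in (-R)..R, q (R + y * Complex.I)‖ ≤ C / R ^ 2 * |R - -R| := by
      refine intervalIntegral.norm_integral_le_of_norm_le_const fun y _ => ?_
      refine hbound _ (by simpa [closedRightHalfPlane] using hR0.le) ?_
      refine le_trans ?_ (Complex.abs_re_le_norm _)
      simp [abs_of_pos hR0]
    have hI : ‖∫ t in (-R)..R, q (t * Complex.I)‖ =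
        ‖(∫ x in (0 : ℝ)..R, q (x + -(R * Complex.I))) - (∫ x in (0 : ℝ)..R, q (x + R * Complex.I))
          + Complex.I * ∫ y in (-R)..R, q (R + y * Complex.I)‖ := by
      rw [sub_eq_zero.1 hrect, norm_mul, Complex.norm_I, one_mul]
    rw [hI]
    refine (norm_add_le _ _).trans ?_
    rw [norm_mul, Complex.norm_I, one_mul]
    refine (add_le_add ((norm_sub_le _ _).trans (add_le_add e1 e2)) e3).trans (le_of_eq ?_)
    rw [sub_zero, sub_neg_eq_add, abs_of_pos hR0, abs_of_pos (by linarith)]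
    field_simp
    ring
  · refine hc.mono fun w hw => ?_
    have := hw.1
    simp [Set.uIcc_of_le hR0.le] at this
    exact this.1
  · refine hd.mono fun w hw => ?_
    have := hw.1
    simp [hR0.le] at this
    exact this.1

/-- The Poisson kernel of the right half plane at height `1`. -/
noncomputable def poissonKernel (u : ℝ) : ℝ := Real.pi⁻¹ * (1 + u ^ 2)⁻¹

theorem poissonKernel_pos (u : ℝ) : 0 < poissonKernel u := by
  unfold poissonKernel
  have := Real.pi_pos
  positivity

theorem isDensity_poissonKernel : IsDensity poissonKernel where
  integrable := integrable_inv_one_add_sq.const_mul _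
  nonneg := Eventually.of_forall fun u => (poissonKernel_pos u).le
  integral_eq_one := by
    simp only [poissonKernel]
    rw [integral_const_mul, integral_univ_inv_one_add_sq, inv_mul_cancel₀ Real.pi_ne_zero]

theorem continuous_poissonKernel : Continuous poissonKernel := by
  unfold poissonKernel
  exact continuous_const.mul ((by fun_prop : Continuous fun u : ℝ => 1 + u ^ 2).inv₀
    fun u => by positivity)

theorem integrable_poissonKernel_dilate {x : ℝ} (hx : 0 < x) (y : ℝ) :
    Integrable fun t => x⁻¹ * poissonKernel ((y - t) / x) :=
  ((isDensity_poissonKernel.integrable.comp_div hx.ne').comp_sub_left y).const_mul _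

theorem integral_poissonKernel_dilate {x : ℝ} (hx : 0 < x) (y : ℝ) :
    ∫ t, x⁻¹ * poissonKernel ((y - t) / x) = 1 := by
  rw [integral_sub_left_eq_self (fun t => x⁻¹ * poissonKernel (t / x)), integral_const_mul,
    Measure.integral_comp_div poissonKernel, isDensity_poissonKernel.integral_eq_one,
    abs_of_pos hx, smul_eq_mul, mul_one, inv_mul_cancel₀ hx.ne']

theorem inv_sub_inv_eq_poissonKernel {z : ℂ} (hz : z ∈ rightHalfPlane) (t : ℝ) :
    (t * Complex.I - z)⁻¹ - (t * Complex.I + starRingEnd ℂ z)⁻¹ =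
      ((-(2 * Real.pi) * (z.re⁻¹ * poissonKernel ((z.im - t) / z.re)) : ℝ) : ℂ) := by
  have hx : 0 < z.re := hz
  have h1 : t * Complex.I - z ≠ 0 := fun h => by
    have := congrArg Complex.re h
    simp at this
    linarith
  have h2 : t * Complex.I + starRingEnd ℂ z ≠ 0 := fun h => by
    have := congrArg Complex.re h
    simp at this
    linarith
  have h3 : (t * Complex.I - z) * (t * Complex.I + starRingEnd ℂ z) =
      ((-(z.re ^ 2 + (z.im - t) ^ 2) : ℝ) : ℂ) := by
    apply Complex.ext
    · simp only [Complex.mul_re, Complex.sub_re, Complex.add_re, Complex.sub_im, Complex.add_im,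
        Complex.mul_im, Complex.ofReal_re, Complex.ofReal_im, Complex.I_re, Complex.I_im,
        Complex.conj_re, Complex.conj_im]
      ring
    · simp only [Complex.mul_re, Complex.sub_re, Complex.add_re, Complex.sub_im, Complex.add_im,
        Complex.mul_im, Complex.ofReal_re, Complex.ofReal_im, Complex.I_re, Complex.I_im,
        Complex.conj_re, Complex.conj_im]
      ring
  have h4 : z + starRingEnd ℂ z = ((2 * z.re : ℝ) : ℂ) := Complex.add_conj z
  rw [inv_sub_inv h1 h2, h3, show t * Complex.I + starRingEnd ℂ z - (t * Complex.I - z) =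
    z + starRingEnd ℂ z by ring, h4, ← Complex.ofReal_div]
  congr 1
  have h5 : 0 < z.re ^ 2 + (z.im - t) ^ 2 := by positivity
  have h6 : 1 + ((z.im - t) / z.re) ^ 2 = (z.re ^ 2 + (z.im - t) ^ 2) / z.re ^ 2 := by
    field_simp
  rw [poissonKernel, h6]
  have := Real.pi_ne_zero
  field_simp

theorem norm_add_conj_ge_re {z w : ℂ} (hw : w ∈ closedRightHalfPlane) :
    z.re ≤ ‖w + starRingEnd ℂ z‖ := by
  refine le_trans ?_ (Complex.re_le_norm _)
  have : 0 ≤ w.re := hw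
  simpa using this

/-- The Poisson formula for functions that are continuous up to the imaginary axis. -/
theorem poisson_formula_of_continuousOn {f : ℂ → ℂ} (hc : ContinuousOn f closedRightHalfPlane)
    (hd : DifferentiableOn ℂ f rightHalfPlane) {C : ℝ}
    (hC : ∀ w ∈ closedRightHalfPlane, ‖f w‖ ≤ C) {z : ℂ} (hz : z ∈ rightHalfPlane) :
    ∫ t : ℝ, (z.re⁻¹ * poissonKernel ((z.im - t) / z.re)) • f (t * Complex.I) = f z := by
  have hx : 0 < z.re := hz
  have hne : ∀ w ∈ closedRightHalfPlane, w + starRingEnd ℂ z ≠ 0 := fun w hw =>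
    norm_pos_iff.1 (hx.trans_le (norm_add_conj_ge_re hw))
  have hC0 : 0 ≤ C := (norm_nonneg _).trans (hC z (rightHalfPlane_subset_closed hz))
  let q : ℂ → ℂ := fun w => dslope f z w - (f w - f z) / (w + starRingEnd ℂ z)
  have hq : ∀ w, w ≠ z →
      q w = (f w - f z) * ((w - z)⁻¹ - (w + starRingEnd ℂ z)⁻¹) := by
    intro w hw
    simp only [q, dslope_of_ne _ hw, slope_def_field]
    ring
  have hq0 : ∫ t : ℝ, q (t * Complex.I) = 0 := by
    refine integral_imaginaryAxis_eq_zero (C := 2 * C * (2 * ‖z‖ * 4)) (R₀ := 2 * ‖z‖) ?_ ?_ ?_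
    · exact ((continuousOn_dslope (closedRightHalfPlane_mem_nhds hz)).2
        ⟨hc, hd.differentiableAt (isOpen_rightHalfPlane.mem_nhds hz)⟩).sub
        ((hc.sub continuousOn_const).div (by fun_prop) hne)
    · exact ((Complex.differentiableOn_dslope (isOpen_rightHalfPlane.mem_nhds hz)).2 hd).sub
        ((hd.sub_const _).div (by fun_prop) fun w hw => hne w (rightHalfPlane_subset_closed hw))
    · intro w hw hwz
      have hz0 : 0 < ‖z‖ := hx.trans_le (Complex.re_le_norm z)
      have hw0 : 0 < ‖w‖ := by linarith
      have hwz' : w ≠ z := by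
        rintro rfl
        linarith
      have b1 : ‖w‖ / 2 ≤ ‖w - z‖ := by
        have := norm_sub_norm_le w z
        linarith
      have b2 : ‖w‖ / 2 ≤ ‖w + starRingEnd ℂ z‖ := by
        have := norm_sub_le (w + starRingEnd ℂ z) (starRingEnd ℂ z)
        rw [add_sub_cancel_right, Complex.norm_conj] at this
        linarith
      have b3 : ‖z + starRingEnd ℂ z‖ ≤ 2 * ‖z‖ := by
        have := norm_add_le z (starRingEnd ℂ z)
        rw [Complex.norm_conj] at this
        linarith
      have b4 : ‖f w - f z‖ ≤ 2 * C := by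
        have := norm_sub_le (f w) (f z)
        linarith [hC w hw, hC z (rightHalfPlane_subset_closed hz)]
      rw [hq w hwz', inv_sub_inv (sub_ne_zero.2 hwz') (hne w hw),
        show w + starRingEnd ℂ z - (w - z) = z + starRingEnd ℂ z by ring, norm_mul, norm_div,
        norm_mul]
      calc ‖f w - f z‖ * (‖z + starRingEnd ℂ z‖ / (‖w - z‖ * ‖w + starRingEnd ℂ z‖))
          ≤ 2 * C * (2 * ‖z‖ / (‖w‖ / 2 * (‖w‖ / 2))) := by gcongr
        _ = 2 * C * (2 * ‖z‖ * 4) / ‖w‖ ^ 2 := by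
          field_simp
          ring
  have hfc : Continuous fun t : ℝ => f (t * Complex.I) :=
    hc.comp_continuous (by fun_prop) mul_I_mem_closedRightHalfPlane
  have hi := integrable_poissonKernel_dilate hx z.im
  have hi1 := integrable_smul_of_bounded hi hfc.aestronglyMeasurable
    (fun t => hC _ (mul_I_mem_closedRightHalfPlane t))
  have hq1 : ∀ t : ℝ, q (t * Complex.I) = ((-(2 * Real.pi) : ℝ) : ℂ) *
      ((z.re⁻¹ * poissonKernel ((z.im - t) / z.re)) • f (t * Complex.I) -
        (z.re⁻¹ * poissonKernel ((z.im - t) / z.re)) • f z) := by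
    intro t
    rw [hq, inv_sub_inv_eq_poissonKernel hz, ← smul_sub, Complex.real_smul, Complex.ofReal_mul]
    · ring
    · rintro h
      rw [← h] at hx
      simp at hx
  simp only [hq1] at hq0
  rw [integral_const_mul, integral_sub hi1 (hi.smul_const _), integral_smul_const,
    integral_poissonKernel_dilate hx, one_smul, mul_eq_zero, sub_eq_zero] at hq0
  refine hq0.resolve_left ?_
  have := Real.pi_pos
  exact_mod_cast (by linarith : -(2 * Real.pi) ≠ 0)

theorem norm_mul_I_add_conj (t : ℝ) (z : ℂ) :
    ‖t * Complex.I + starRingEnd ℂ z‖ = ‖t * Complex.I - z‖ := by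
  rw [← Complex.norm_conj (t * Complex.I - z), ← norm_neg]
  congr 1
  rw [map_sub, map_mul, Complex.conj_ofReal, Complex.conj_I]
  ring

theorem re_le_norm_mul_I_sub (t : ℝ) (z : ℂ) : z.re ≤ ‖t * Complex.I - z‖ := by
  rw [← norm_mul_I_add_conj]
  exact norm_add_conj_ge_re (mul_I_mem_closedRightHalfPlane t)

theorem norm_div_add_conj_le {G : ℂ → ℂ} {L : NNReal} (hG : LipschitzWith L G) {z : ℂ}
    (hz : z ∈ rightHalfPlane) {w : ℂ} (hw : w ∈ closedRightHalfPlane) :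
    ‖G w / (w + starRingEnd ℂ z)‖ ≤ L + (‖G 0‖ + L * ‖z‖) / z.re := by
  have hx : 0 < z.re := hz
  have h1 := norm_add_conj_ge_re (z := z) hw
  have h2 : ‖G w‖ ≤ ‖G 0‖ + L * ‖w‖ := by
    have := hG.norm_sub_le w 0
    rw [sub_zero] at this
    linarith [norm_sub_norm_le (G w) (G 0)]
  have h3 : ‖w‖ ≤ ‖w + starRingEnd ℂ z‖ + ‖z‖ := by
    have := norm_sub_le (w + starRingEnd ℂ z) (starRingEnd ℂ z)
    rwa [add_sub_cancel_right, Complex.norm_conj] at this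
  rw [norm_div, div_le_iff₀ (hx.trans_le h1), add_mul]
  have h4 : ‖G 0‖ + L * ‖z‖ ≤ (‖G 0‖ + L * ‖z‖) / z.re * ‖w + starRingEnd ℂ z‖ := by
    rw [div_mul_eq_mul_div, le_div_iff₀ hx]
    gcongr
  nlinarith [mul_le_mul_of_nonneg_left h3 L.coe_nonneg]

/-- The derivative of a Lipschitz holomorphic function is controlled by its boundary values. -/
theorem norm_deriv_le_integral {G : ℂ → ℂ} {L : NNReal} (hG : LipschitzWith L G)
    (hd : DifferentiableOn ℂ G rightHalfPlane) {z : ℂ} (hz : z ∈ rightHalfPlane) :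
    ‖deriv G z‖ ≤ 3 * ∫ t : ℝ, z.re⁻¹ * poissonKernel ((z.im - t) / z.re) *
      (‖G (t * Complex.I)‖ / ‖t * Complex.I - z‖) := by
  have hx : 0 < z.re := hz
  have hne : ∀ w ∈ closedRightHalfPlane, w + starRingEnd ℂ z ≠ 0 := fun w hw =>
    norm_pos_iff.1 (hx.trans_le (norm_add_conj_ge_re hw))
  set p : ℝ → ℝ := fun t => z.re⁻¹ * poissonKernel ((z.im - t) / z.re) with hp
  have hp0 : ∀ t, 0 ≤ p t := fun t => mul_nonneg (inv_nonneg.2 hx.le) (poissonKernel_pos _).le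
  have hpi : Integrable p := integrable_poissonKernel_dilate hx z.im
  set J := ∫ t : ℝ, p t * (‖G (t * Complex.I)‖ / ‖t * Complex.I - z‖) with hJ
  have hzt : ∀ t : ℝ, 0 < ‖t * Complex.I - z‖ := fun t => hx.trans_le (re_le_norm_mul_I_sub t z)
  have hJi : Integrable fun t : ℝ => p t * (‖G (t * Complex.I)‖ / ‖t * Complex.I - z‖) := by
    refine hpi.mul_bdd (c := L + (‖G 0‖ + L * ‖z‖) / z.re) ?_ (Eventually.of_forall fun t => ?_)
    · refine Continuous.aestronglyMeasurable (Continuous.div₀ ?_ (by fun_prop) fun t => (hzt t).ne')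
      exact (hG.continuous.comp (by fun_prop)).norm
    · rw [← norm_mul_I_add_conj, ← norm_div, norm_norm]
      exact norm_div_add_conj_le hG hz (mul_I_mem_closedRightHalfPlane t)
  have hGz : ‖G z‖ / z.re ≤ 2 * J := by
    have h := poisson_formula_of_continuousOn (f := fun w => G w / (w + starRingEnd ℂ z))
      (hG.continuous.continuousOn.div (by fun_prop) hne)
      (hd.div (by fun_prop) fun w hw => hne w (rightHalfPlane_subset_closed hw))
      (fun w hw => norm_div_add_conj_le hG hz hw) hz
    have h2 : ‖G z / (z + starRingEnd ℂ z)‖ ≤ J := by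
      rw [← h]
      refine norm_integral_le_of_norm_le hJi (Eventually.of_forall fun t => ?_)
      rw [norm_smul, Real.norm_of_nonneg (hp0 t), norm_div, norm_mul_I_add_conj]
    rw [Complex.add_conj, norm_div, Complex.norm_real, Real.norm_of_nonneg (by positivity),
      div_le_iff₀ (by positivity)] at h2
    rw [div_le_iff₀ hx]
    linarith
  have hdz : DifferentiableAt ℂ G z := hd.differentiableAt (isOpen_rightHalfPlane.mem_nhds hz)
  have hslope := poisson_formula_of_continuousOn (f := dslope G z) (C := L)
    ((continuousOn_dslope (closedRightHalfPlane_mem_nhds hz)).2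
      ⟨hG.continuous.continuousOn, hdz⟩)
    ((Complex.differentiableOn_dslope (isOpen_rightHalfPlane.mem_nhds hz)).2 hd)
    (fun w _ => by
      rcases eq_or_ne w z with rfl | hw
      · rw [dslope_same]
        exact norm_deriv_le_of_lipschitz hG
      · rw [dslope_of_ne _ hw, slope_def_field, norm_div,
          div_le_iff₀ (norm_pos_iff.2 (sub_ne_zero.2 hw))]
        exact hG.norm_sub_le w z) hz
  rw [dslope_same] at hslope
  rw [← hslope]
  have hi2 : Integrable fun t => p t * (‖G z‖ / z.re) := hpi.mul_const _
  calc _ ≤ ∫ t : ℝ, (p t * (‖G (t * Complex.I)‖ / ‖t * Complex.I - z‖) +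
          p t * (‖G z‖ / z.re)) := by
        refine norm_integral_le_of_norm_le (hJi.add hi2) (Eventually.of_forall fun t => ?_)
        have hw : (t : ℂ) * Complex.I ≠ z := sub_ne_zero.1 (norm_pos_iff.1 (hzt t))
        rw [norm_smul, Real.norm_of_nonneg (hp0 t), dslope_of_ne _ hw, slope_def_field, norm_div,
          ← mul_add]
        refine mul_le_mul_of_nonneg_left ?_ (hp0 t)
        calc _ ≤ (‖G (t * Complex.I)‖ + ‖G z‖) / ‖t * Complex.I - z‖ := by
              gcongr
              exact norm_sub_le _ _
          _ ≤ _ := by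
              rw [add_div]
              gcongr
              exact re_le_norm_mul_I_sub t z
    _ = J + ‖G z‖ / z.re := by
        rw [integral_add hJi hi2, integral_mul_const, integral_poissonKernel_dilate hx, one_mul]
    _ ≤ 3 * J := by linarith

theorem poissonKernel_le_of_abs_sub_le {u v M : ℝ} (h : |u - v| ≤ M) :
    poissonKernel u ≤ (2 + 2 * M ^ 2) * poissonKernel v := by
  have h1 : (u - v) ^ 2 ≤ M ^ 2 := by
    rw [← sq_abs]
    gcongr
  have h2 : (1 + u ^ 2)⁻¹ ≤ (2 + 2 * M ^ 2) * (1 + v ^ 2)⁻¹ := by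
    rw [← div_eq_mul_inv, ← one_div, div_le_div_iff₀ (by positivity) (by positivity)]
    nlinarith [sq_nonneg (u - v + u), sq_nonneg (2 * u - v), sq_nonneg (M * u)]
  unfold poissonKernel
  calc Real.pi⁻¹ * (1 + u ^ 2)⁻¹ ≤ Real.pi⁻¹ * ((2 + 2 * M ^ 2) * (1 + v ^ 2)⁻¹) :=
        mul_le_mul_of_nonneg_left h2 (inv_nonneg.2 Real.pi_pos.le)
    _ = _ := by ring

/-- In a cone with vertex `i y`, the derivative of a Lipschitz holomorphic function that vanishes
at `i y` is controlled by Poisson means of its boundary difference quotients at `i y`. -/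
theorem norm_deriv_le_of_mem_stolzCone {G : ℂ → ℂ} {L : NNReal} (hG : LipschitzWith L G)
    (hd : DifferentiableOn ℂ G rightHalfPlane) {y M : ℝ} (hy : G (y * Complex.I) = 0)
    {z : ℂ} (hz : z ∈ stolzCone y M) :
    ‖deriv G z‖ ≤ 3 * ((2 + 2 * M ^ 2) * (1 + M)) *
      ∫ u, poissonKernel u * (‖G ((y - z.re * u : ℝ) * Complex.I)‖ / |z.re * u|) := by
  obtain ⟨hx, hzM⟩ := hz
  have hM : 0 ≤ M := by
    by_contra! h
    nlinarith [abs_nonneg (z.im - y)]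
  set e : ℝ → ℝ := fun t => ‖G (t * Complex.I)‖ / |y - t| with he
  have heL : ∀ t, e t ≤ L := fun t => by
    have h := hG.norm_sub_le (t * Complex.I) (y * Complex.I)
    rw [hy, sub_zero, ← sub_mul, norm_mul, Complex.norm_I, mul_one, ← Complex.ofReal_sub,
      Complex.norm_real, Real.norm_eq_abs, abs_sub_comm] at h
    exact div_le_of_le_mul₀ (abs_nonneg _) L.coe_nonneg h
  have he0 : ∀ t, 0 ≤ e t := fun t => by positivity
  have hem : Measurable e := by
    have h1 : Continuous fun t : ℝ => ‖G (t * Complex.I)‖ :=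
      (hG.continuous.comp (by fun_prop)).norm
    exact h1.measurable.div (by fun_prop)
  have hsub : ∫ t, z.re⁻¹ * poissonKernel ((y - t) / z.re) * e t =
      ∫ u, poissonKernel u * (‖G ((y - z.re * u : ℝ) * Complex.I)‖ / |z.re * u|) := by
    rw [← integral_sub_left_eq_self _ volume y]
    have := Measure.integral_comp_div
      (fun u => poissonKernel u * (‖G ((y - z.re * u : ℝ) * Complex.I)‖ / |z.re * u|)) z.re
    rw [abs_of_pos hx, smul_eq_mul] at this
    rw [eq_comm, ← eq_inv_mul_iff_mul_eq₀ hx.ne'] at this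
    rw [this, ← integral_const_mul]
    refine integral_congr_ae (Eventually.of_forall fun t => ?_)
    simp only [he, sub_sub_cancel, mul_div_cancel₀ t hx.ne', mul_assoc]
  have hi : Integrable fun t => z.re⁻¹ * poissonKernel ((y - t) / z.re) * e t := by
    refine (integrable_poissonKernel_dilate hx y).mul_bdd (c := L) hem.aestronglyMeasurable
      (Eventually.of_forall fun t => ?_)
    rw [Real.norm_of_nonneg (he0 t)]
    exact heL t
  refine (norm_deriv_le_integral hG hd hx).trans ?_
  rw [mul_assoc, ← hsub]
  refine mul_le_mul_of_nonneg_left ?_ zero_le_three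
  rw [← integral_const_mul]
  refine integral_mono_of_nonneg (Eventually.of_forall fun t => ?_)
    (hi.const_mul _) (Eventually.of_forall fun t => ?_)
  · have := poissonKernel_pos ((z.im - t) / z.re)
    simp only [Pi.zero_apply]
    positivity
  · have hK : poissonKernel ((z.im - t) / z.re) ≤
        (2 + 2 * M ^ 2) * poissonKernel ((y - t) / z.re) := by
      apply poissonKernel_le_of_abs_sub_le
      rw [← sub_div, sub_sub_sub_cancel_right, abs_div, abs_of_pos hx]
      exact (div_le_iff₀ hx).2 hzM
    have hzt : 0 < ‖t * Complex.I - z‖ := hx.trans_le (re_le_norm_mul_I_sub t z)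
    have hq : ‖G (t * Complex.I)‖ / ‖t * Complex.I - z‖ ≤ (1 + M) * e t := by
      rcases eq_or_ne t y with rfl | hty
      · rw [hy]
        simp [he]
      have hty' : 0 < |y - t| := abs_pos.2 (sub_ne_zero.2 hty.symm)
      have h1 : |y - t| ≤ (1 + M) * ‖t * Complex.I - z‖ := by
        have h2 : |t - z.im| ≤ ‖t * Complex.I - z‖ := by
          simpa using Complex.abs_im_le_norm (t * Complex.I - z)
        have h3 := re_le_norm_mul_I_sub t z
        have h4 := abs_sub_le y z.im t
        rw [abs_sub_comm y z.im, abs_sub_comm z.im t] at h4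
        nlinarith [mul_le_mul_of_nonneg_left h3 hM]
      rw [he, div_le_iff₀ hzt]
      simp only
      rw [← mul_div_assoc, div_mul_eq_mul_div, le_div_iff₀ hty']
      calc ‖G (t * Complex.I)‖ * |y - t|
          ≤ ‖G (t * Complex.I)‖ * ((1 + M) * ‖t * Complex.I - z‖) := by gcongr
        _ = _ := by ring
    have := poissonKernel_pos ((y - t) / z.re)
    calc z.re⁻¹ * poissonKernel ((z.im - t) / z.re) * (‖G (t * Complex.I)‖ / ‖t * Complex.I - z‖)
        ≤ z.re⁻¹ * ((2 + 2 * M ^ 2) * poissonKernel ((y - t) / z.re)) * ((1 + M) * e t) := by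
          gcongr
      _ = _ := by ring

theorem tendsto_integral_poissonKernel_mul {G : ℂ → ℂ} {L : NNReal} (hG : LipschitzWith L G)
    {y : ℝ} (hy : G (y * Complex.I) = 0)
    (h0 : HasDerivAt (fun t : ℝ => G (t * Complex.I)) 0 y) :
    Tendsto (fun x : ℝ => ∫ u, poissonKernel u * (‖G ((y - x * u : ℝ) * Complex.I)‖ / |x * u|))
      (𝓝 0) (𝓝 0) := by
  have hGc := hG.continuous
  have key := tendsto_integral_filter_of_dominated_convergence (μ := volume) (l := 𝓝 (0 : ℝ))
    (F := fun x u => poissonKernel u * (‖G ((y - x * u : ℝ) * Complex.I)‖ / |x * u|))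
    (f := fun _ => 0) (fun u => poissonKernel u * L) ?_ ?_ ?_ ?_
  · simpa using key
  · refine Eventually.of_forall fun x => ?_
    refine continuous_poissonKernel.aestronglyMeasurable.mul (Measurable.aestronglyMeasurable ?_)
    have h1 : Continuous fun u : ℝ => ‖G ((y - x * u : ℝ) * Complex.I)‖ :=
      (hGc.comp (by fun_prop)).norm
    exact h1.measurable.div (by fun_prop)
  · refine Eventually.of_forall fun x => Eventually.of_forall fun u => ?_
    have h := hG.norm_sub_le ((y - x * u : ℝ) * Complex.I) (y * Complex.I)
    rw [hy, sub_zero, ← sub_mul, norm_mul, Complex.norm_I, mul_one, ← Complex.ofReal_sub,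
      Complex.norm_real, Real.norm_eq_abs, sub_sub_cancel_left, abs_neg] at h
    rw [norm_mul, Real.norm_of_nonneg (poissonKernel_pos u).le,
      Real.norm_of_nonneg (by positivity)]
    exact mul_le_mul_of_nonneg_left (div_le_of_le_mul₀ (abs_nonneg _) L.coe_nonneg h)
      (poissonKernel_pos u).le
  · exact isDensity_poissonKernel.integrable.mul_const _
  · refine Eventually.of_forall fun u => ?_
    have h1 : Tendsto (fun t : ℝ => ‖G (t * Complex.I)‖ / |y - t|) (𝓝 y) (𝓝 0) := by
      have := (hasDerivAt_iff_isLittleO.1 h0).norm_norm.tendsto_div_nhds_zero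
      simpa [hy, abs_sub_comm] using this
    have h2 : Tendsto (fun x : ℝ => y - x * u) (𝓝 0) (𝓝 y) := by
      have : Continuous fun x : ℝ => y - x * u := by fun_prop
      simpa using this.tendsto 0
    have := (h1.comp h2).const_mul (poissonKernel u)
    simpa using this

theorem MemHInfty.exists_lipschitz_primitive {φ : ℂ → ℂ} (hφ : MemHInfty φ) :
    ∃ (F : ℂ → ℂ) (L : NNReal), LipschitzWith L F ∧
      ∀ z ∈ rightHalfPlane, HasDerivAt F (φ z) z := by
  obtain ⟨C, hC⟩ := hφ.bounded
  obtain ⟨F, hF⟩ := exists_primitive hφ.analytic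
  have hL : LipschitzOnWith C.toNNReal F rightHalfPlane :=
    convex_rightHalfPlane.lipschitzOnWith_of_nnnorm_deriv_le (𝕜 := ℂ)
      (fun z hz => (hF z hz).differentiableAt) fun z hz => by
        rw [(hF z hz).deriv, ← NNReal.coe_le_coe, coe_nnnorm]
        exact (hC z hz).trans (Real.le_coe_toNNReal C)
  obtain ⟨F', hF', heq⟩ := hL.extend_finite_dimension
  refine ⟨F', _, hF', fun z hz => (hF z hz).congr_of_eventuallyEq ?_⟩
  filter_upwards [isOpen_rightHalfPlane.mem_nhds hz] with w hw
  exact (heq hw).symm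

/-- **Fatou's theorem** for bounded analytic functions on the right half plane. -/
theorem MemHInfty.ae_exists_nontangential_limit {φ : ℂ → ℂ} (hφ : MemHInfty φ) :
    ∀ᵐ y : ℝ, ∃ c, Tendsto φ (nontangential y) (𝓝 c) := by
  obtain ⟨F, L, hF, hFd⟩ := hφ.exists_lipschitz_primitive
  have hu : LipschitzWith L fun t : ℝ => F (t * Complex.I) := by
    have h1 : LipschitzWith 1 fun t : ℝ => (t : ℂ) * Complex.I :=
      LipschitzWith.of_dist_le_mul fun s t => by
        rw [dist_eq_norm, ← sub_mul, ← Complex.ofReal_sub, norm_mul, Complex.norm_real]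
        simp [dist_eq_norm]
    have h2 := hF.comp h1
    rwa [mul_one] at h2
  filter_upwards [hu.ae_differentiableAt_real] with y hy
  set d := deriv (fun t : ℝ => F (t * Complex.I)) y
  set c : ℂ := -Complex.I * d with hc
  let G : ℂ → ℂ := fun w => F w - (F (y * Complex.I) + c * (w - y * Complex.I))
  have hG : LipschitzWith (L + ‖c‖₊) G := by
    refine hF.sub (LipschitzWith.of_dist_le_mul fun v w => ?_)
    rw [dist_eq_norm, dist_eq_norm, add_sub_add_left_eq_sub, ← mul_sub, norm_mul,
      sub_sub_sub_cancel_right, coe_nnnorm]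
  have hGd : ∀ z ∈ rightHalfPlane, HasDerivAt G (φ z - c) z := fun z hz => by
    have h := (((hasDerivAt_id z).sub_const (y * Complex.I)).const_mul c).const_add
      (F (y * Complex.I))
    rw [mul_one] at h
    exact (hFd z hz).sub h
  have hGy : G (y * Complex.I) = 0 := by simp [G]
  have hG0 : HasDerivAt (fun t : ℝ => G (t * Complex.I)) 0 y := by
    have h1 : HasDerivAt (fun t : ℝ => (t : ℂ) * Complex.I) Complex.I y := by
      simpa using (Complex.ofRealCLM.hasDerivAt (x := y)).mul_const Complex.I
    have h2 := hy.hasDerivAt.sub (((h1.sub_const (y * Complex.I)).const_mul c).const_add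
      (F (y * Complex.I)))
    have h3 : c * Complex.I = d := by
      rw [hc]
      linear_combination -d * Complex.I_mul_I
    rwa [h3, sub_self] at h2
  refine ⟨c, ?_⟩
  rw [nontangential, tendsto_iSup]
  intro M
  rw [tendsto_iff_norm_sub_tendsto_zero]
  have hre : Tendsto Complex.re (𝓝[stolzCone y M] (Complex.I * y)) (𝓝 0) := by
    have := Complex.continuous_re.tendsto (Complex.I * y)
    rw [Complex.I_mul_re, Complex.ofReal_im, neg_zero] at this
    exact this.mono_left nhdsWithin_le_nhds
  have hlim := ((tendsto_integral_poissonKernel_mul hG hGy hG0).comp hre).const_mul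
    (3 * ((2 + 2 * M ^ 2) * (1 + M)))
  rw [mul_zero] at hlim
  refine squeeze_zero' (Eventually.of_forall fun _ => norm_nonneg _) ?_ hlim
  filter_upwards [self_mem_nhdsWithin] with z hz
  rw [← (hGd z hz.1).deriv]
  exact norm_deriv_le_of_mem_stolzCone hG
    (fun w hw => (hGd w hw).differentiableAt.differentiableWithinAt) hGy hz

theorem MemHInfty.ae_tendsto_boundaryFunction {φ : ℂ → ℂ} (hφ : MemHInfty φ) :
    ∀ᵐ y : ℝ, Tendsto φ (nontangential y) (𝓝 (boundaryFunction φ y)) := by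
  filter_upwards [hφ.ae_exists_nontangential_limit] with y hy
  exact tendsto_nhds_limUnder hy

theorem tendsto_add_nontangential (y : ℝ) :
    Tendsto (fun n : ℕ => (((1 / (n + 1) : ℝ) : ℂ) + y * Complex.I)) atTop (nontangential y) := by
  refine Tendsto.mono_right ?_ (le_iSup _ (0 : ℝ))
  refine tendsto_nhdsWithin_iff.2 ⟨?_, Eventually.of_forall fun n => ⟨?_, ?_⟩⟩
  · have h := ((Complex.continuous_ofReal.tendsto 0).comp
      tendsto_one_div_add_atTop_nhds_zero_nat).add_const (y * Complex.I)
    rw [Complex.ofReal_zero, zero_add, mul_comm] at h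
    exact h.congr fun n => by simp [mul_comm]
  · rw [Complex.add_re, Complex.ofReal_re, Complex.re_ofReal_mul, Complex.I_re, mul_zero, add_zero]
    positivity
  · simp

theorem MemHInfty.continuous_vertical {φ : ℂ → ℂ} (hφ : MemHInfty φ) {x : ℝ} (hx : 0 < x) :
    Continuous fun t : ℝ => φ (x + t * Complex.I) :=
  hφ.analytic.continuousOn.comp_continuous (by fun_prop) fun t => by simpa [rightHalfPlane]

theorem MemHInfty.memLp_boundaryFunction {φ : ℂ → ℂ} (hφ : MemHInfty φ) :
    MemLp (boundaryFunction φ) ∞ volume := by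
  obtain ⟨C, hC⟩ := hφ.bounded
  have hlim : ∀ᵐ y : ℝ, Tendsto (fun n : ℕ => φ (((1 / (n + 1) : ℝ) : ℂ) + y * Complex.I)) atTop
      (𝓝 (boundaryFunction φ y)) := by
    filter_upwards [hφ.ae_tendsto_boundaryFunction] with y hy
    exact hy.comp (tendsto_add_nontangential y)
  refine memLp_top_of_bound (C := C) (aestronglyMeasurable_of_tendsto_ae atTop
    (fun n : ℕ => (hφ.continuous_vertical (x := 1 / (n + 1))
      (by positivity)).aestronglyMeasurable) hlim) ?_
  filter_upwards [hlim] with y hy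
  refine le_of_tendsto' hy.norm fun n => hC _ ?_
  change 0 < Complex.re _
  rw [Complex.add_re, Complex.ofReal_re, Complex.re_ofReal_mul, Complex.I_re, mul_zero, add_zero]
  positivity

/-- The Poisson formula for bounded analytic functions on the right half plane. -/
theorem MemHInfty.poisson_formula {φ : ℂ → ℂ} (hφ : MemHInfty φ) {x : ℝ} (hx : 0 < x) (y : ℝ) :
    ∫ t, (x⁻¹ * poissonKernel (t / x)) • boundaryFunction φ (y - t) = φ (x + Complex.I * y) := by
  obtain ⟨C, hC⟩ := hφ.bounded
  set z : ℂ := x + Complex.I * y with hz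
  have hzre : z.re = x := by simp [hz]
  have hzim : z.im = y := by simp [hz]
  have hzm : z ∈ rightHalfPlane := by
    change 0 < z.re
    rwa [hzre]
  have hswap := integral_sub_left_eq_self
    (fun t => (x⁻¹ * poissonKernel (t / x)) • boundaryFunction φ (y - t)) volume y
  simp only [sub_sub_cancel] at hswap
  rw [← hswap]
  have hmem : ∀ (n : ℕ), ∀ w ∈ closedRightHalfPlane,
      ((1 / (n + 1) : ℝ) : ℂ) + w ∈ rightHalfPlane := by
    intro n w hw
    have h1 : 0 ≤ w.re := hw
    change 0 < Complex.re _
    rw [Complex.add_re, Complex.ofReal_re]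
    positivity
  have hdiff : ∀ (n : ℕ), ∀ w ∈ closedRightHalfPlane,
      DifferentiableAt ℂ (fun w => φ (((1 / (n + 1) : ℝ) : ℂ) + w)) w := fun n w hw =>
    (hφ.analytic.differentiableAt (isOpen_rightHalfPlane.mem_nhds (hmem n w hw))).comp w
      (by fun_prop)
  have hP : ∀ n : ℕ, ∫ t : ℝ, (x⁻¹ * poissonKernel ((y - t) / x)) •
      φ (((1 / (n + 1) : ℝ) : ℂ) + t * Complex.I) = φ (((1 / (n + 1) : ℝ) : ℂ) + z) := by
    intro n
    have := poisson_formula_of_continuousOn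
      (f := fun w => φ (((1 / (n + 1) : ℝ) : ℂ) + w)) (C := C)
      (fun w hw => (hdiff n w hw).continuousAt.continuousWithinAt)
      (fun w hw => (hdiff n w (rightHalfPlane_subset_closed hw)).differentiableWithinAt)
      (fun w hw => hC _ (hmem n w hw)) hzm
    rwa [hzre, hzim] at this
  have h1 : Tendsto (fun n : ℕ => φ (((1 / (n + 1) : ℝ) : ℂ) + z)) atTop (𝓝 (φ z)) := by
    have h := ((Complex.continuous_ofReal.tendsto 0).comp
      tendsto_one_div_add_atTop_nhds_zero_nat).add_const z
    rw [Complex.ofReal_zero, zero_add] at h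
    exact (hφ.analytic.differentiableAt
      (isOpen_rightHalfPlane.mem_nhds hzm)).continuousAt.tendsto.comp h
  refine tendsto_nhds_unique ?_ h1
  simp only [← hP]
  have hi := integrable_poissonKernel_dilate hx y
  refine tendsto_integral_of_dominated_convergence
    (fun t => ‖x⁻¹ * poissonKernel ((y - t) / x)‖ * C)
    (fun n => hi.aestronglyMeasurable.smul (hφ.continuous_vertical (x := 1 / (n + 1))
      (by positivity)).aestronglyMeasurable) (hi.norm.mul_const C)
    (fun n => Eventually.of_forall fun t => ?_) ?_
  · rw [norm_smul]
    exact mul_le_mul_of_nonneg_left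
      (hC _ (hmem n _ (mul_I_mem_closedRightHalfPlane t))) (norm_nonneg _)
  · filter_upwards [hφ.ae_tendsto_boundaryFunction] with t ht
    exact (ht.comp (tendsto_add_nontangential t)).const_smul _

/-- The uniform density on `[-1, 1]`. -/
noncomputable def boxKernel : ℝ → ℝ := (Set.Ioc (-1 : ℝ) 1).indicator fun _ => 1 / 2

theorem isDensity_boxKernel : IsDensity boxKernel where
  integrable := (integrable_indicator_iff measurableSet_Ioc).2 (by simp)
  nonneg := Eventually.of_forall fun u => Set.indicator_nonneg (fun _ _ => by norm_num) u
  integral_eq_one := by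
    rw [boxKernel, integral_indicator measurableSet_Ioc]
    simp
    norm_num

theorem integral_boxKernel_dilate {x : ℝ} (hx : 0 < x) (y : ℝ) (g : ℝ → ℂ) :
    ∫ t, (x⁻¹ * boxKernel (t / x)) • g (y - t) =
      (1 / (2 * x) : ℂ) * ∫ t in (y - x)..(y + x), g t := by
  have h1 : ∀ t, (x⁻¹ * boxKernel (t / x)) • g (y - t) =
      (Set.Ioc (-x) x).indicator (fun t => (1 / (2 * x) : ℂ) * g (y - t)) t := by
    intro t
    have hiff : t / x ∈ Set.Ioc (-1 : ℝ) 1 ↔ t ∈ Set.Ioc (-x) x := by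
      rw [Set.mem_Ioc, Set.mem_Ioc, lt_div_iff₀ hx, div_le_iff₀ hx, neg_one_mul, one_mul]
    by_cases ht : t ∈ Set.Ioc (-x) x
    · rw [Set.indicator_of_mem ht, boxKernel, Set.indicator_of_mem (hiff.2 ht), Complex.real_smul]
      push_cast
      ring
    · rw [Set.indicator_of_notMem ht, boxKernel, Set.indicator_of_notMem (fun h => ht (hiff.1 h)),
        mul_zero, zero_smul]
  simp only [h1]
  rw [integral_indicator measurableSet_Ioc, integral_const_mul,
    ← intervalIntegral.integral_of_le (by linarith),
    intervalIntegral.integral_comp_sub_left (fun t => g t), sub_neg_eq_add]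

end AlmostConvergence

theorem theorem4p2 (φ : ℂ → ℂ) (hφ : AlmostConvergence.MemHInfty φ) (α : ℂ) :
    (∀ᵐ y : ℝ, Tendsto φ (AlmostConvergence.nontangential y)
      (𝓝 (AlmostConvergence.boundaryFunction φ y))) ∧
    ∃ hb : MemLp (AlmostConvergence.boundaryFunction φ) ∞ volume,
      (AlmostConvergence.AlmostConvergent (hb.toLp (AlmostConvergence.boundaryFunction φ)) α ↔
        TendstoUniformly (fun (x y : ℝ) => φ (x + Complex.I * y)) (fun _ => α) atTop) ∧
      (AlmostConvergence.AlmostConvergent (hb.toLp (AlmostConvergence.boundaryFunction φ)) α ↔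
        TendstoUniformly
          (fun (θ y : ℝ) => (1 / (2 * θ) : ℂ) *
            ∫ t in (y - θ)..(y + θ), AlmostConvergence.boundaryFunction φ t)
          (fun _ => α) atTop) := by
  have hb := hφ.memLp_boundaryFunction
  have hcongr : ∀ (f : ℝ → ℝ) (y : ℝ),
      ∫ t, f t • hb.toLp (AlmostConvergence.boundaryFunction φ) (y - t) =
        ∫ t, f t • AlmostConvergence.boundaryFunction φ (y - t) := fun f y =>
    congrFun (AlmostConvergence.conv_congr_right f hb.coeFn_toLp) y
  refine ⟨hφ.ae_tendsto_boundaryFunction, hb, ?_, ?_⟩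
  · refine AlmostConvergence.isDensity_poissonKernel.almostConvergent_iff _ α fun x hx y => ?_
    rw [hcongr, hφ.poisson_formula (by linarith)]
  · refine AlmostConvergence.isDensity_boxKernel.almostConvergent_iff _ α fun x hx y => ?_
    rw [hcongr, AlmostConvergence.integral_boxKernel_dilate (by linarith)]
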